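/- Let $K$ be a field, let $n$ be a non-negative integer, let $X=(x_{ij})_{1\le i,j\le n}$ be an $n\times n$ matrix of variables and let $S=K[x_{ij} : 1\le i,j\le n]$ be the polynomial ring over $K$ in these variables. Let $G$ be a simple graph on the vertex set $[n]=\{1,\dots,n\}$ with edge set $E(G)$, and let $P_G\subset S$ be the ideal generated by the diagonal $2$-minors $$f_{ij}=x_{ii}x_{jj}-x_{ij}x_{ji}\qquad (1\le i<j\le n,\ \{i,j\}\in E(G)).$$ Then the ring $R_G=S/P_G$ is a normal domain, that is, $R_G$ is an integral domain which is integrally closed in its field of fractions. -/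

import Mathlib

/-- The diagonal `2`-minor `f_ij = x_ii x_jj - x_ij x_ji` of the generic `n × n` matrix `(x_ij)`,
in the polynomial ring `S = K[x_ij : i, j ∈ [n]]`; the vertex set `[n]` is modelled by `Fin n`. -/
noncomputable def diagonalMinor (K : Type*) [Field K] {n : ℕ} (i j : Fin n) :
    MvPolynomial (Fin n × Fin n) K :=
  MvPolynomial.X (i, i) * MvPolynomial.X (j, j) - MvPolynomial.X (i, j) * MvPolynomial.X (j, i)

/-- The ideal `P_G` of `S` generated by the `f_ij`, `i < j`, with `{i, j}` an edge of `G`. -/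
noncomputable def diagonalMinorIdeal (K : Type*) [Field K] {n : ℕ} (G : SimpleGraph (Fin n)) :
    Ideal (MvPolynomial (Fin n × Fin n) K) :=
  Ideal.span {f | ∃ i j : Fin n, i < j ∧ G.Adj i j ∧ f = diagonalMinor K i j}

/-- The ring `R_G = S / P_G`. -/
abbrev DiagonalMinorRing (K : Type*) [Field K] {n : ℕ} (G : SimpleGraph (Fin n)) :=
  MvPolynomial (Fin n × Fin n) K ⧸ diagonalMinorIdeal K G

/-!
The ring `R_G` is obtained from a polynomial ring over `K` (in the variables `x_ij` that are not
indexed by an edge) by adjoining, for each edge `{i, j}`, two new elements `a = x_ij`, `b = x_ji`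
subject to the single relation `a * b = x_ii * x_jj`. So it suffices to treat one such step: if `R`
is a normal domain and `c ≠ 0`, then `A = R[a, b] / (a * b - c)` is a normal domain containing `R`.

For this, inverting `a` in `A` gives the Laurent polynomial ring `R[a, a⁻¹]`, since then
`b = c / a` is redundant; likewise for `b`. Laurent polynomial rings over normal domains are normal
domains, `a` is a nonzerodivisor of `A`, and `b` is a nonzerodivisor modulo `a`. The last fact gives
`A = A[1/a] ∩ A[1/b]` inside the fraction field (`IsIntegrallyClosed.of_away_of_away`), so `A` is
normal.

The steps are chained together by means of universal properties (`IsUniversalFactorization`,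
`IsUniversalFactorizationFamily`), which avoids manipulating iterated quotients of polynomial rings.
-/

open Polynomial

universe u v

/-! ### Normality from two localizations -/

/-- An element of the fraction field that is integral over `A` has denominator a power of `a` as
soon as the localization of `A` away from `a` is normal. -/
theorem IsIntegral.exists_pow_mul_eq_of_away {A : Type u} [CommRing A] [IsDomain A] {a : A}
    (ha : a ≠ 0) [IsIntegrallyClosed (Localization.Away a)] {x : FractionRing A}
    (hx : IsIntegral A x) :
    ∃ (n : ℕ) (y : A), algebraMap A (FractionRing A) (a ^ n) * x = algebraMap A _ y := by
  have hle : Submonoid.powers a ≤ nonZeroDivisors A :=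
    powers_le_nonZeroDivisors_of_noZeroDivisors ha
  let g : Localization.Away a →+* FractionRing A :=
    IsLocalization.map (FractionRing A) (T := nonZeroDivisors A) (RingHom.id A) hle
  let := g.toAlgebra
  have : IsScalarTower A (Localization.Away a) (FractionRing A) :=
    IsScalarTower.of_algebraMap_eq fun z =>
      (IsLocalization.map_eq (S := Localization.Away a) (Q := FractionRing A)
        (g := RingHom.id A) hle z).symm
  have : IsFractionRing (Localization.Away a) (FractionRing A) :=
    IsFractionRing.isFractionRing_of_isDomain_of_isLocalization (Submonoid.powers a) _ _
  obtain ⟨y, hy⟩ := IsIntegrallyClosed.isIntegral_iff.mp (hx.tower_top (A := Localization.Away a))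
  obtain ⟨⟨z, ⟨_, n, rfl⟩⟩, hz⟩ := IsLocalization.surj (Submonoid.powers a) y
  refine ⟨n, z, ?_⟩
  rw [← hy, IsScalarTower.algebraMap_apply A (Localization.Away a) (FractionRing A),
    IsScalarTower.algebraMap_apply A (Localization.Away a) (FractionRing A), ← hz, map_mul,
    mul_comm]

/-- If `b` is a nonzerodivisor modulo `a`, then a domain `A` is the intersection of its localizations
away from `a` and away from `b`, so it is normal when both of these are. -/
theorem IsIntegrallyClosed.of_away_of_away {A : Type u} [CommRing A] [IsDomain A] {a b : A}
    (ha : a ≠ 0) (hb : b ≠ 0) (hab : ∀ x, a ∣ b * x → a ∣ x)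
    [IsIntegrallyClosed (Localization.Away a)] [IsIntegrallyClosed (Localization.Away b)] :
    IsIntegrallyClosed A := by
  have hpow : ∀ m x, a ∣ b ^ m * x → a ∣ x := by
    intro m
    induction m with
    | zero => intro x h; simpa using h
    | succ m ih => intro x h; exact ih x (hab _ (by rwa [← mul_assoc, ← pow_succ']))
  have hpow' : ∀ m n x, a ^ n ∣ b ^ m * x → a ^ n ∣ x := by
    intro m n
    induction n with
    | zero => intro x _; simp
    | succ n ih =>
      intro x h
      obtain ⟨y, rfl⟩ := hpow m x ((dvd_pow_self a n.succ_ne_zero).trans h)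
      rw [pow_succ', mul_left_comm] at h
      rw [pow_succ']
      exact mul_dvd_mul_left a (ih y (mul_dvd_mul_iff_left ha |>.mp h))
  refine (isIntegrallyClosed_iff (FractionRing A)).mpr fun {x} hx => ?_
  obtain ⟨n, y, hy⟩ := hx.exists_pow_mul_eq_of_away ha
  obtain ⟨m, z, hz⟩ := hx.exists_pow_mul_eq_of_away hb
  have h : a ^ n * z = b ^ m * y := by
    apply IsFractionRing.injective A (FractionRing A)
    rw [map_mul, map_mul, ← hy, ← hz]
    ring
  obtain ⟨w, rfl⟩ := hpow' m n y ⟨z, h.symm⟩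
  refine ⟨w, ?_⟩
  have h0 : algebraMap A (FractionRing A) (a ^ n) ≠ 0 := by
    simpa using fun h => absurd h ha
  apply mul_left_cancel₀ h0
  rw [hy, map_mul]

/-! ### Laurent polynomial rings -/

theorem LaurentPolynomial.isIntegrallyClosed (R : Type u) [CommRing R] [IsDomain R]
    [IsIntegrallyClosed R] : IsIntegrallyClosed (LaurentPolynomial R) :=
  isIntegrallyClosed_of_isLocalization _ (Submonoid.powers (X : R[X]))
    (powers_le_nonZeroDivisors_of_noZeroDivisors X_ne_zero)

theorem LaurentPolynomial.ringHom_ext_of_C_of_T {R : Type u} {B : Type v} [CommRing R] [CommRing B]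
    {f g : LaurentPolynomial R →+* B} (hC : ∀ r, f (C r) = g (C r)) (hT : f (T 1) = g (T 1)) :
    f = g := by
  apply IsLocalization.ringHom_ext (Submonoid.powers (X : R[X]))
  apply Polynomial.ringHom_ext
  · intro r
    simpa [LaurentPolynomial.algebraMap_eq_toLaurent] using hC r
  · simpa [LaurentPolynomial.algebraMap_eq_toLaurent] using hT

/-! ### Adjoining a factorization of one element -/

/-- `A`, with the homomorphism `f : R → A` and `a b : A`, is the universal commutative `R`-algebra
with a factorization `a * b = c` of `c : R`; that is, `A ≅ R[a, b] / (a * b - c)`. The test rings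
range over the universe of `R` and `A` only. Ring homomorphisms out of `R` are used in place of
`R`-algebra structures, so that universal properties can be composed without changing instances. -/
structure IsUniversalFactorization {R A : Type u} [CommRing R] [CommRing A] (c : R) (f : R →+* A)
    (a b : A) : Prop where
  mul_eq : a * b = f c
  exists_lift : ∀ {B : Type u} [CommRing B] (g : R →+* B) (x y : B), x * y = g c →
    ∃ h : A →+* B, h.comp f = g ∧ h a = x ∧ h b = y
  hom_ext : ∀ {B : Type u} [CommRing B] {h k : A →+* B}, h.comp f = k.comp f → h a = k a →
    h b = k b → h = k

namespace IsUniversalFactorization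

variable {R A : Type u} [CommRing R] [CommRing A] {c : R} {f : R →+* A} {a b : A}

theorem symm (H : IsUniversalFactorization c f a b) : IsUniversalFactorization c f b a where
  mul_eq := by rw [mul_comm, H.mul_eq]
  exists_lift g x y hxy := by
    obtain ⟨h, h1, h2, h3⟩ := H.exists_lift g y x (by rw [mul_comm, hxy])
    exact ⟨h, h1, h3, h2⟩
  hom_ext h1 h2 h3 := H.hom_ext h1 h3 h2

theorem exists_laurent_hom (H : IsUniversalFactorization c f a b) :
    ∃ h : A →+* LaurentPolynomial R, h.comp f = LaurentPolynomial.C ∧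
      h a = LaurentPolynomial.T 1 ∧ h b = LaurentPolynomial.C c * LaurentPolynomial.T (-1) :=
  H.exists_lift _ _ _ (by
    rw [mul_left_comm, ← LaurentPolynomial.T_add]; simp)

/-- The composite of `f` with the map from `A` to Laurent polynomials is the inclusion of constants. -/
theorem injective (H : IsUniversalFactorization c f a b) : Function.Injective f := by
  obtain ⟨h, h1, -⟩ := H.exists_laurent_hom
  have : Function.Injective (h.comp f) := by
    rw [h1]
    intro r r' hr
    apply C_injective
    apply toLaurent_injective
    simpa using hr
  exact Function.Injective.of_comp (f := h) this

theorem left_ne_zero (H : IsUniversalFactorization c f a b) (hc : c ≠ 0) : a ≠ 0 := by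
  rintro rfl
  have := H.mul_eq
  rw [zero_mul] at this
  exact hc (H.injective (by rw [← this, map_zero]))

/-- Once `a` is inverted, `b = c / a` is redundant. -/
theorem nonempty_away_equiv_laurentPolynomial (H : IsUniversalFactorization c f a b) :
    Nonempty (Localization.Away a ≃+* LaurentPolynomial R) := by
  obtain ⟨h, h1, h2, h3⟩ := H.exists_laurent_hom
  have hu : IsUnit (h a) := by rw [h2]; exact LaurentPolynomial.isUnit_T 1
  let i := algebraMap A (Localization.Away a)
  have hia : IsUnit (i a) := IsLocalization.Away.algebraMap_isUnit a
  let φ : Localization.Away a →+* LaurentPolynomial R := IsLocalization.Away.lift a hu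
  have hφ : ∀ z, φ (i z) = h z := fun z => IsLocalization.Away.lift_eq a hu z
  let ψ : LaurentPolynomial R →+* Localization.Away a :=
    LaurentPolynomial.eval₂ (i.comp f) hia.unit
  have hψC : ∀ r, ψ (LaurentPolynomial.C r) = i (f r) := fun r => by simp [ψ]
  have hψT : ψ (LaurentPolynomial.T 1) = i a := by simp [ψ]
  have hhf : ∀ r, h (f r) = LaurentPolynomial.C r := fun r => RingHom.congr_fun h1 r
  refine ⟨RingEquiv.ofRingHom φ ψ ?_ ?_⟩
  · apply LaurentPolynomial.ringHom_ext_of_C_of_T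
    · intro r
      simp [hψC, hφ, hhf]
    · simp [hψT, hφ, h2]
  · apply IsLocalization.ringHom_ext (Submonoid.powers a)
    have ea : ψ (h a) = i a := by rw [h2, hψT]
    have ef : ∀ r, ψ (h (f r)) = i (f r) := fun r => by rw [hhf, hψC]
    apply H.hom_ext
    · ext r
      simpa [hφ, i] using ef r
    · simpa [hφ, i] using ea
    · have : i a * ψ (h b) = i a * i b := by
        rw [← ea, ← map_mul, ← map_mul, H.mul_eq, ef, ea, ← map_mul, H.mul_eq]
      simpa [hφ, i] using hia.mul_left_cancel this

/-- The two conditions on `a` and `b` say that `a, b` is a regular sequence in `A`, without the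
requirement that it generates a proper ideal. -/
theorem isDomain_and_isIntegrallyClosed [IsDomain R] [IsIntegrallyClosed R]
    (H : IsUniversalFactorization c f a b) (hc : c ≠ 0) (ha : ∀ x, a * x = 0 → x = 0)
    (hab : ∀ x, a ∣ b * x → a ∣ x) : IsDomain A ∧ IsIntegrallyClosed A := by
  have := LaurentPolynomial.isIntegrallyClosed R
  obtain ⟨e⟩ := H.nonempty_away_equiv_laurentPolynomial
  obtain ⟨e'⟩ := H.symm.nonempty_away_equiv_laurentPolynomial
  have hle : Submonoid.powers a ≤ nonZeroDivisors A := by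
    rw [Submonoid.powers_le, mem_nonZeroDivisors_iff]
    exact ⟨ha, fun x hx => ha x (by rwa [mul_comm])⟩
  have hinj : Function.Injective (e.toRingHom.comp (algebraMap A (Localization.Away a))) :=
    e.injective.comp (IsLocalization.injective (Localization.Away a) hle)
  have hA : IsDomain A := hinj.isDomain _
  have := IsIntegrallyClosed.of_equiv e.symm
  have := IsIntegrallyClosed.of_equiv e'.symm
  exact ⟨hA, .of_away_of_away (H.left_ne_zero hc) (H.symm.left_ne_zero hc) hab⟩

end IsUniversalFactorization

/-- The polynomial `a * b - c`, with `a` the inner and `b` the outer variable of `R[X][X]`. -/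
noncomputable def factorizationPolynomial {R : Type u} [CommRing R] (c : R) : R[X][X] :=
  C X * X - C (C c)

namespace factorizationPolynomial

variable {R : Type u} [CommRing R]

theorem C_X_dvd_of_map_eq_zero {q : R[X][X]} (hq : q.map (evalRingHom (0 : R)) = 0) :
    C X ∣ q := by
  rw [C_dvd_iff_dvd_coeff]
  intro i
  rw [X_dvd_iff, coeff_zero_eq_eval_zero]
  simpa using congrArg (fun p => p.coeff i) hq

theorem map_eval_zero (c : R) :
    (factorizationPolynomial c).map (evalRingHom (0 : R)) = - C c := by
  simp [factorizationPolynomial]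

theorem C_X_dvd_of_C_X_dvd_mul [IsDomain R] {c : R} (hc : c ≠ 0) {r : R[X][X]}
    (h : C X ∣ factorizationPolynomial c * r) : C X ∣ r := by
  obtain ⟨q, hq⟩ := h
  apply C_X_dvd_of_map_eq_zero
  have := congrArg (Polynomial.map (evalRingHom (0 : R))) hq
  simpa [map_eval_zero, hc] using this

theorem isUniversalFactorization (c : R) :
    IsUniversalFactorization c
      ((AdjoinRoot.of (factorizationPolynomial c)).comp C)
      (AdjoinRoot.of (factorizationPolynomial c) X) (AdjoinRoot.root _) where
  mul_eq := by
    have := AdjoinRoot.eval₂_root (factorizationPolynomial c)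
    rwa [factorizationPolynomial, eval₂_sub, eval₂_mul, eval₂_C, eval₂_X, eval₂_C,
      sub_eq_zero] at this
  exists_lift g x y hxy := by
    refine ⟨AdjoinRoot.lift (eval₂RingHom g x) y ?_, ?_, ?_, ?_⟩
    · simp [factorizationPolynomial, hxy]
    · ext r; simp
    · simp
    · simp
  hom_ext h1 h2 h3 := by
    apply Ideal.Quotient.ringHom_ext
    apply Polynomial.ringHom_ext'
    · apply Polynomial.ringHom_ext'
      · exact h1
      · exact h2
    · exact h3

/-- The inner variable `a` is a nonzerodivisor modulo `a * b - c`: this polynomial becomes `-c` at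
`a = 0`, so it is a nonzerodivisor modulo `a`. -/
theorem eq_zero_of_mul_eq_zero [IsDomain R] {c : R} (hc : c ≠ 0)
    (x : AdjoinRoot (factorizationPolynomial c)) (hx : AdjoinRoot.of _ X * x = 0) : x = 0 := by
  obtain ⟨q, rfl⟩ := AdjoinRoot.mk_surjective x
  rw [← AdjoinRoot.mk_C, ← map_mul, AdjoinRoot.mk_eq_zero] at hx
  obtain ⟨r, hr⟩ := hx
  obtain ⟨r, rfl⟩ := C_X_dvd_of_C_X_dvd_mul hc ⟨q, hr.symm⟩
  rw [AdjoinRoot.mk_eq_zero]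
  refine ⟨r, mul_left_cancel₀ (C_ne_zero.mpr X_ne_zero) (hr.trans ?_)⟩
  ring

/-- Modulo the inner variable `a`, the ring `R[a, b] / (a * b - c)` becomes `(R / c)[b]`, where `b`
is a nonzerodivisor. -/
theorem dvd_of_dvd_root_mul [IsDomain R] {c : R} (hc : c ≠ 0)
    (x : AdjoinRoot (factorizationPolynomial c))
    (hx : AdjoinRoot.of _ X ∣ AdjoinRoot.root _ * x) : AdjoinRoot.of _ X ∣ x := by
  obtain ⟨q, rfl⟩ := AdjoinRoot.mk_surjective x
  obtain ⟨y, hy⟩ := hx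
  obtain ⟨y, rfl⟩ := AdjoinRoot.mk_surjective y
  rw [← AdjoinRoot.mk_C, ← AdjoinRoot.mk_X, ← map_mul, ← map_mul, AdjoinRoot.mk_eq_mk] at hy
  obtain ⟨z, hz⟩ := hy
  have hred := congrArg (Polynomial.map (evalRingHom (0 : R))) hz
  simp only [Polynomial.map_sub, Polynomial.map_mul, map_X, map_C, coe_evalRingHom, eval_X,
    map_zero, zero_mul, sub_zero, map_eval_zero] at hred
  -- Modulo the inner variable the relation reads `b * q = -c * z`, so `b` divides `z`.
  have hzX : X ∣ z.map (evalRingHom (0 : R)) := by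
    rw [X_dvd_iff]
    have := congrArg (fun p => p.coeff 0) hred
    simpa [hc] using this
  obtain ⟨w, hw⟩ := hzX
  have hq : q.map (evalRingHom (0 : R)) = - C c * w :=
    mul_left_cancel₀ X_ne_zero (hred.trans (by rw [hw]; ring))
  have hdvd : C X ∣ q + C (C c) * w.map C := by
    apply C_X_dvd_of_map_eq_zero
    have hwC : (w.map C).map (evalRingHom (0 : R)) = w := by
      rw [Polynomial.map_map]
      convert Polynomial.map_id
      ext; simp
    simp [hq, hwC]
  -- Since `c = a * b` in the quotient, `q = a * t - c * w` is a multiple of `a` there.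
  obtain ⟨t, ht⟩ := hdvd
  refine ⟨AdjoinRoot.mk _ (t - X * w.map C), ?_⟩
  rw [← AdjoinRoot.mk_C, ← map_mul, AdjoinRoot.mk_eq_mk]
  refine ⟨w.map C, ?_⟩
  rw [factorizationPolynomial]
  linear_combination ht

end factorizationPolynomial

theorem exists_isUniversalFactorization_normal {R : Type u} [CommRing R] [IsDomain R]
    [IsIntegrallyClosed R] {c : R} (hc : c ≠ 0) :
    ∃ (A : Type u) (_ : CommRing A) (f : R →+* A) (a b : A), IsDomain A ∧ IsIntegrallyClosed A ∧
      IsUniversalFactorization c f a b :=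
  have H := factorizationPolynomial.isUniversalFactorization c
  have h := H.isDomain_and_isIntegrallyClosed hc
    (factorizationPolynomial.eq_zero_of_mul_eq_zero hc)
    (factorizationPolynomial.dvd_of_dvd_root_mul hc)
  ⟨_, _, _, _, _, h.1, h.2, H⟩

/-! ### Adjoining factorizations of finitely many elements -/

/-- `A`, with `f : R → A` and the elements `a i`, `b i` for `i ∈ s`, is the universal commutative
`R`-algebra with factorizations `a i * b i = c i` for `i ∈ s`. The values of `a`, `b`, `c` outside
`s` play no role; this makes induction on the finite set `s` possible over a fixed index type. -/
structure IsUniversalFactorizationFamily {R A : Type u} {ι : Type v} [CommRing R] [CommRing A]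
    (s : Finset ι) (c : ι → R) (f : R →+* A) (a b : ι → A) : Prop where
  mul_eq : ∀ i ∈ s, a i * b i = f (c i)
  exists_lift : ∀ {B : Type u} [CommRing B] (g : R →+* B) (x y : ι → B),
    (∀ i ∈ s, x i * y i = g (c i)) →
    ∃ h : A →+* B, h.comp f = g ∧ ∀ i ∈ s, h (a i) = x i ∧ h (b i) = y i
  hom_ext : ∀ {B : Type u} [CommRing B] {h k : A →+* B}, h.comp f = k.comp f →
    (∀ i ∈ s, h (a i) = k (a i) ∧ h (b i) = k (b i)) → h = k

/-- Each step keeps the remaining elements `c i` nonzero, since `R` embeds into the new ring. -/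
theorem exists_isUniversalFactorizationFamily_normal {ι : Type v} (s : Finset ι) :
    ∀ {R : Type u} [CommRing R] [IsDomain R] [IsIntegrallyClosed R] (c : ι → R),
      (∀ i ∈ s, c i ≠ 0) →
      ∃ (A : Type u) (_ : CommRing A) (f : R →+* A) (a b : ι → A),
        IsDomain A ∧ IsIntegrallyClosed A ∧ IsUniversalFactorizationFamily s c f a b := by
  classical
  induction s using Finset.induction_on with
  | empty =>
    intro R _ _ _ c _
    refine ⟨R, _, RingHom.id R, c, c, inferInstance, inferInstance, ?_, ?_, ?_⟩
    · simp
    · intro B _ g x y _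
      exact ⟨g, by simp⟩
    · intro B _ h k hk _
      simpa using hk
  | insert j s hj ih =>
    intro R _ _ _ c hc
    obtain ⟨R', _, f', a', b', _, _, H'⟩ :=
      exists_isUniversalFactorization_normal (hc j (Finset.mem_insert_self j s))
    obtain ⟨A, _, f, a, b, hA, hA', H⟩ := ih (fun i => f' (c i)) fun i hi =>
      (map_ne_zero_iff f' H'.injective).mpr (hc i (Finset.mem_insert_of_mem hi))
    have hne : ∀ i ∈ s, i ≠ j := fun i hi h => hj (h ▸ hi)
    refine ⟨A, _, f.comp f', Function.update a j (f a'), Function.update b j (f b'), hA, hA',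
      ?_, ?_, ?_⟩
    · intro i hi
      rcases Finset.mem_insert.mp hi with rfl | hi
      · simp [← map_mul, H'.mul_eq]
      · simpa [hne i hi] using H.mul_eq i hi
    · intro B _ g x y hxy
      obtain ⟨h', h1', h2', h3'⟩ :=
        H'.exists_lift g (x j) (y j) (hxy j (Finset.mem_insert_self j s))
      obtain ⟨h, h1, h2⟩ := H.exists_lift h' x y fun i hi => by
        rw [hxy i (Finset.mem_insert_of_mem hi), ← h1', RingHom.comp_apply]
      refine ⟨h, by rw [← RingHom.comp_assoc, h1, h1'], fun i hi => ?_⟩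
      rcases Finset.mem_insert.mp hi with rfl | hi
      · simp [← RingHom.comp_apply, h1, h2', h3']
      · simpa [hne i hi] using h2 i hi
    · intro B _ h k h1 h2
      apply H.hom_ext
      · apply H'.hom_ext
        · rw [RingHom.comp_assoc, h1, RingHom.comp_assoc]
        · simpa using (h2 j (Finset.mem_insert_self j s)).1
        · simpa using (h2 j (Finset.mem_insert_self j s)).2
      · intro i hi
        simpa [hne i hi] using h2 i (Finset.mem_insert_of_mem hi)

/-! ### The ring of diagonal minors -/

namespace DiagonalMinorRing

variable (K : Type u) [Field K] {n : ℕ} (G : SimpleGraph (Fin n))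

/-- The polynomial ring over `K` in the variables `x_ij` such that `{i, j}` is not an edge of `G`;
in particular it contains all diagonal variables `x_ii`. -/
abbrev NonEdgeRing : Type u := MvPolynomial {p : Fin n × Fin n // ¬ G.Adj p.1 p.2} K

/-- The element `x_ii * x_jj` of `NonEdgeRing K G`, for a pair `(i, j)`. -/
noncomputable def diagonalProduct (p : Fin n × Fin n) : NonEdgeRing K G :=
  MvPolynomial.X ⟨(p.1, p.1), G.irrefl⟩ * MvPolynomial.X ⟨(p.2, p.2), G.irrefl⟩

theorem diagonalProduct_ne_zero (p : Fin n × Fin n) : diagonalProduct K G p ≠ 0 :=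
  mul_ne_zero (MvPolynomial.X_ne_zero _) (MvPolynomial.X_ne_zero _)

/-- `R_G` is obtained from the polynomial ring in the non-edge variables by adjoining a
factorization `x_ij * x_ji` of `x_ii * x_jj` for each edge `{i, j}` with `i < j`. -/
theorem nonempty_equiv_of_isUniversalFactorizationFamily {s : Finset (Fin n × Fin n)}
    (hs : ∀ p, p ∈ s ↔ p.1 < p.2 ∧ G.Adj p.1 p.2) {A : Type u} [CommRing A]
    {f : NonEdgeRing K G →+* A} {a b : Fin n × Fin n → A}
    (H : IsUniversalFactorizationFamily s (diagonalProduct K G) f a b) :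
    Nonempty (A ≃+* DiagonalMinorRing K G) := by
  classical
  let π := Ideal.Quotient.mk (diagonalMinorIdeal K G)
  let g : NonEdgeRing K G →+* DiagonalMinorRing K G :=
    MvPolynomial.eval₂Hom (π.comp MvPolynomial.C) fun q => π (MvPolynomial.X q.1)
  obtain ⟨φ, hφf, hφ⟩ := H.exists_lift g (fun p => π (MvPolynomial.X p))
    (fun p => π (MvPolynomial.X p.swap)) (by
      rintro ⟨i, j⟩ hp
      obtain ⟨hlt, hadj⟩ := (hs _).mp hp
      have hmem : diagonalMinor K i j ∈ diagonalMinorIdeal K G :=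
        Ideal.subset_span ⟨i, j, hlt, hadj, rfl⟩
      have := Ideal.Quotient.eq_zero_iff_mem.mpr hmem
      rw [diagonalMinor, map_sub, sub_eq_zero, map_mul, map_mul] at this
      simpa [g, diagonalProduct] using this.symm)
  let val : Fin n × Fin n → A := fun p =>
    if h : G.Adj p.1 p.2 then (if p.1 < p.2 then a p else b p.swap) else f (MvPolynomial.X ⟨p, h⟩)
  let ψ₀ : MvPolynomial (Fin n × Fin n) K →+* A :=
    MvPolynomial.eval₂Hom (f.comp MvPolynomial.C) val
  have hψ₀ : ∀ p ∈ diagonalMinorIdeal K G, ψ₀ p = 0 := by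
    suffices diagonalMinorIdeal K G ≤ RingHom.ker ψ₀ from fun p hp => this hp
    rw [diagonalMinorIdeal, Ideal.span_le]
    rintro _ ⟨i, j, hlt, hadj, rfl⟩
    have := H.mul_eq (i, j) ((hs _).mpr ⟨hlt, hadj⟩)
    simp [ψ₀, val, diagonalMinor, hadj, hadj.symm, hlt, hlt.not_gt, this, diagonalProduct]
  let ψ : DiagonalMinorRing K G →+* A := Ideal.Quotient.lift _ ψ₀ hψ₀
  have hψ : ∀ p, ψ (π p) = ψ₀ p := fun p => Ideal.Quotient.lift_mk _ _ _
  have hφf' : ∀ r, φ (f r) = g r := fun r => RingHom.congr_fun hφf r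
  refine ⟨RingEquiv.ofRingHom φ ψ ?_ ?_⟩
  · apply Ideal.Quotient.ringHom_ext
    apply MvPolynomial.ringHom_ext
    · intro r
      change φ (ψ (π _)) = π _
      simp [hψ, ψ₀, hφf', g]
    · rintro ⟨i, j⟩
      change φ (ψ (π _)) = π _
      by_cases hadj : G.Adj i j
      · rcases lt_or_gt_of_ne hadj.ne with hlt | hlt
        · simpa [hψ, ψ₀, val, hadj, hlt] using (hφ (i, j) ((hs _).mpr ⟨hlt, hadj⟩)).1
        · simpa [hψ, ψ₀, val, hadj, hlt.not_gt] using (hφ (j, i) ((hs _).mpr ⟨hlt, hadj.symm⟩)).2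
      · simp [hψ, ψ₀, val, hadj, hφf', g]
  · apply H.hom_ext
    · apply MvPolynomial.ringHom_ext
      · intro r
        simp [hφf', g, hψ, ψ₀]
      · rintro ⟨p, hp⟩
        simp [hφf', g, hψ, ψ₀, val, hp]
    · rintro ⟨i, j⟩ hp
      obtain ⟨hlt, hadj⟩ := (hs _).mp hp
      obtain ⟨h1, h2⟩ := hφ _ hp
      simp [h1, h2, hψ, ψ₀, val, hadj, hadj.symm, hlt, hlt.not_gt]

end DiagonalMinorRing

/-- `R_G` is a normal domain: an integral domain that is integrally closed in its field of
fractions. -/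
theorem corollary1p4 (K : Type*) [Field K] (n : ℕ) (G : SimpleGraph (Fin n)) :
    IsDomain (DiagonalMinorRing K G) ∧ IsIntegrallyClosed (DiagonalMinorRing K G) := by
  classical
  obtain ⟨A, _, f, a, b, _, _, H⟩ := exists_isUniversalFactorizationFamily_normal
    (Finset.univ.filter fun p : Fin n × Fin n => p.1 < p.2 ∧ G.Adj p.1 p.2)
    (DiagonalMinorRing.diagonalProduct K G)
    fun p _ => DiagonalMinorRing.diagonalProduct_ne_zero K G p
  obtain ⟨e⟩ := DiagonalMinorRing.nonempty_equiv_of_isUniversalFactorizationFamily K G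
    (fun p => by simp) H
  exact ⟨e.symm.injective.isDomain e.symm.toRingHom, .of_equiv e⟩
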